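/- Let $m \ge 0$ and $M \ge 1$ be integers. For a square matrix $A = (a_{ij})$ of size $n\times n$ let $\operatorname{perm}(A) = \sum_{\sigma \in S_n} \prod_{i=1}^n a_{i\sigma(i)}$ be its permanent. Let $\mathcal{P}_M$ be the set of $M\times M$ permutation matrices, and let $\mathcal{P}_M^m$ be the set of all $mM \times mM$ block matrices $P = (P_{ij})_{1\le i,j\le m}$ with every block $P_{ij} \in \mathcal{P}_M$. For a real $m\times m$ matrix $\theta = (\theta_{ij})$ and $P \in \mathcal{P}_M^m$, let the $P$-lifting $\theta^{\uparrow P}$ be the $mM\times mM$ block matrix whose $(i,j)$ block is $\theta_{ij}P_{ij}$. For $\theta$ with non-negative entries, the degree-$M$ Bethe permanent of $\theta$ is $$\operatorname{perm}_{\mathrm{B},M}(\theta) = \left( \frac{1}{|\mathcal{P}_M^m|} \sum_{P \in \mathcal{P}_M^m} \operatorname{perm}(\theta^{\uparrow P}) \right)^{1/M}.$$ Then, for every $m\times m$ matrix $\theta$ with non-negative real entries and every integer $M\ge 1$, $$\operatorname{perm}_{\mathrm{B},M}(\theta) \le \operatorname{perm}(\theta).$$ -/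

import Mathlib

noncomputable section

namespace BethePermanent

/-- The set `𝒫_M` of all `M × M` permutation matrices. -/
def permutationMatrices (M : ℕ) : Set (Matrix (Fin M) (Fin M) ℝ) :=
  {A | ∃ σ : Equiv.Perm (Fin M), A = σ.permMatrix ℝ}

/-- The `(i, j)` block, of size `M × M`, of a matrix made of `m × m` such blocks.  Rows and columns
of an `mM × mM` matrix are indexed by pairs (block index, index inside the block). -/
def block {m M : ℕ} (P : Matrix (Fin m × Fin M) (Fin m × Fin M) ℝ) (i j : Fin m) :
    Matrix (Fin M) (Fin M) ℝ :=
  Matrix.of fun k l => P (i, k) (j, l)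

/-- The set `𝒫_M^m` of all `mM × mM` matrices all of whose `M × M` blocks are permutation
matrices. -/
def blockPermutationMatrices (m M : ℕ) : Set (Matrix (Fin m × Fin M) (Fin m × Fin M) ℝ) :=
  {P | ∀ i j : Fin m, block P i j ∈ permutationMatrices M}

/-- The block matrix `(P_{ij})` whose blocks are the matrices of given permutations. -/
def ofPerms {m M : ℕ} (σ : Fin m → Fin m → Equiv.Perm (Fin M)) :
    Matrix (Fin m × Fin M) (Fin m × Fin M) ℝ :=
  Matrix.of fun a b => (σ a.1 b.1).permMatrix ℝ a.2 b.2

theorem blockPermutationMatrices_eq_range (m M : ℕ) :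
    blockPermutationMatrices m M = Set.range (ofPerms (m := m) (M := M)) := by
  ext P
  constructor
  · intro h
    choose σ hσ using h
    refine ⟨σ, ?_⟩
    ext ⟨i, k⟩ ⟨j, l⟩
    exact (congrFun (congrFun (hσ i j) k) l).symm
  · rintro ⟨σ, rfl⟩ i j
    exact ⟨σ i j, rfl⟩

theorem blockPermutationMatrices_finite (m M : ℕ) : (blockPermutationMatrices m M).Finite := by
  rw [blockPermutationMatrices_eq_range]
  exact Set.finite_range _

/-- The `P`-lifting of `θ`: the block matrix whose `(i, j)` block is `θ i j • P_{ij}`. -/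
def lifting {m M : ℕ} (θ : Matrix (Fin m) (Fin m) ℝ)
    (P : Matrix (Fin m × Fin M) (Fin m × Fin M) ℝ) :
    Matrix (Fin m × Fin M) (Fin m × Fin M) ℝ :=
  Matrix.of fun a b => (θ a.1 b.1 • block P a.1 b.1) a.2 b.2

/-- The arithmetic average of the permanent of the `P`-lifting of `θ` over all `P ∈ 𝒫_M^m`. -/
def averageLiftPermanent {m : ℕ} (M : ℕ) (θ : Matrix (Fin m) (Fin m) ℝ) : ℝ :=
  (∑ P ∈ (blockPermutationMatrices_finite m M).toFinset, (lifting θ P).permanent) /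
    ((blockPermutationMatrices_finite m M).toFinset.card : ℝ)

/-- The degree-`M` Bethe permanent of `θ` (meant for `M ≥ 1` and non-negative `θ`). -/
def bethePermanent {m : ℕ} (M : ℕ) (θ : Matrix (Fin m) (Fin m) ℝ) : ℝ :=
  averageLiftPermanent M θ ^ (1 / (M : ℝ))

end BethePermanent

end

open MvPolynomial Finset

open scoped Nat

namespace BethePermanent

/-! The average over lifts is at most `∑ N_k W_k θ^k`. Here `k` runs over exponent matrices with all
line sums `M`, and `N_k` is the coefficient of `x^k` in `(∏_i ∑_j x_ij)^M`. The weight `W_k` is `∏_j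
multinomial(k_·j) / ∏_ij choose(M, k_ij)`. So it suffices that `N_k W_k` is at most the coefficient
of `x^k` in `perm(x)^M`.

The polynomials `hitOnce I C` interpolate between the product of row sums (`C = ∅`) and the generic
permanent (`C = univ`). Adding a column `j` to `C` accounts for the factor of `W_k` at `j`
(`coeff_hitOnce_pow_mul_multinomial_le`). Split `hitOnce I C` as `∑_T F_T` by the fibre `T` over
`j`. In the `M`-th power, at most `∏_i choose(M, k_ij)` tuples of fibres contribute to `x^k`. Each
contributes at most what `P = ∏_i F_{i}^k_ij` does, while `P` occurs `multinomial(k_·j)` times in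
`hitOnce I (insert j C) ^ M`. The comparison with `P` iterates `F_∅ F_T ≤ F_{i} F_{T∖i}`, an
instance of `matchingSum_submodular`. Inequalities between polynomials over `ℕ` are stated with
`AddLE`, which implies the coefficientwise order. -/

/-- The algebraic preorder of a semiring: `b` is obtained from `a` by adding something. -/
def AddLE {R : Type*} [Add R] (a b : R) : Prop := ∃ h, b = a + h

namespace AddLE

variable {R : Type*} [CommSemiring R] {a b c d : R}

theorem refl (a : R) : AddLE a a := ⟨0, (add_zero a).symm⟩

theorem trans (h₁ : AddLE a b) (h₂ : AddLE b c) : AddLE a c := by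
  obtain ⟨x, rfl⟩ := h₁
  obtain ⟨y, rfl⟩ := h₂
  exact ⟨x + y, add_assoc _ _ _⟩

theorem add (h₁ : AddLE a b) (h₂ : AddLE c d) : AddLE (a + c) (b + d) := by
  obtain ⟨x, rfl⟩ := h₁
  obtain ⟨y, rfl⟩ := h₂
  exact ⟨x + y, by ring⟩

theorem mul_left (c : R) (h : AddLE a b) : AddLE (c * a) (c * b) := by
  obtain ⟨x, rfl⟩ := h
  exact ⟨c * x, mul_add _ _ _⟩

theorem mul_right (c : R) (h : AddLE a b) : AddLE (a * c) (b * c) := by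
  obtain ⟨x, rfl⟩ := h
  exact ⟨x * c, add_mul _ _ _⟩

theorem sum {ι : Type*} (s : Finset ι) {f g : ι → R} (h : ∀ i ∈ s, AddLE (f i) (g i)) :
    AddLE (∑ i ∈ s, f i) (∑ i ∈ s, g i) := by
  classical
  induction s using Finset.induction_on with
  | empty => exact refl _
  | insert i s hi ih =>
    rw [sum_insert hi, sum_insert hi]
    exact add (h i (mem_insert_self _ _)) (ih fun j hj => h j (mem_insert_of_mem hj))

theorem sum_subset {ι : Type*} {s t : Finset ι} (hst : s ⊆ t) (f : ι → R) :
    AddLE (∑ i ∈ s, f i) (∑ i ∈ t, f i) := by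
  classical
  exact ⟨∑ i ∈ t \ s, f i, by rw [add_comm, sum_sdiff hst]⟩

theorem coeff_le {σ : Type*} {p q : MvPolynomial σ ℕ} (h : AddLE p q) (k : σ →₀ ℕ) :
    coeff k p ≤ coeff k q := by
  obtain ⟨x, rfl⟩ := h
  rw [coeff_add]
  exact Nat.le_add_right _ _

end AddLE

/-! ### Weighted matchings covering a set of columns, and their submodularity. -/

/-- The indicator function of a finite set as an exponent vector. -/
noncomputable def indicatorExp {J : Type*} [DecidableEq J] (C : Finset J) : J →₀ ℕ :=
  Finsupp.onFinset C (fun j => if j ∈ C then 1 else 0) (by intro j; simp)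

theorem indicatorExp_apply {J : Type*} [DecidableEq J] (C : Finset J) (j : J) :
    indicatorExp C j = if j ∈ C then 1 else 0 := rfl

theorem support_indicatorExp {J : Type*} [DecidableEq J] (C : Finset J) :
    (indicatorExp C).support = C := by
  ext j
  simp [indicatorExp_apply]

theorem indicatorExp_sub_single {J : Type*} [DecidableEq J] (C : Finset J) (j : J) :
    indicatorExp C - Finsupp.single j 1 = indicatorExp (C.erase j) := by
  ext l
  rw [Finsupp.tsub_apply, indicatorExp_apply, indicatorExp_apply, Finsupp.single_apply]
  by_cases h : j = l
  · subst h; simp; split_ifs <;> rfl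
  · simp [h, Ne.symm h]

section Matching

variable {I J A : Type*} [Fintype J] [DecidableEq I] [DecidableEq J] [CommSemiring A]

/-- The weighted number of matchings between rows `R` and columns `C` that cover `C`, where a row
`i` has weight `a i j` when matched to `j` and weight `c i` when unmatched. -/
noncomputable def matchingSum (c : I → A) (a : I → J → A) (R : Finset I) (C : Finset J) : A :=
  coeff (indicatorExp C)
    (∏ i ∈ R, (MvPolynomial.C (c i) + ∑ j, MvPolynomial.C (a i j) * X j))

theorem matchingSum_insert_row (c : I → A) (a : I → J → A) {R : Finset I} {i : I} (hi : i ∉ R)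
    (C : Finset J) :
    matchingSum c a (insert i R) C =
      c i * matchingSum c a R C + ∑ j ∈ C, a i j * matchingSum c a R (C.erase j) := by
  unfold matchingSum
  rw [prod_insert hi, add_mul, coeff_add, coeff_C_mul, sum_mul, coeff_sum]
  congr 1
  rw [← sum_subset (subset_univ C)]
  · refine sum_congr rfl fun j hj => ?_
    rw [mul_assoc, coeff_C_mul, mul_comm (X j), coeff_mul_X', support_indicatorExp, if_pos hj,
      indicatorExp_sub_single]
  · intro j _ hj
    rw [mul_assoc, coeff_C_mul, mul_comm (X j), coeff_mul_X', support_indicatorExp, if_neg hj,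
      mul_zero]

omit [DecidableEq I] in
theorem matchingSum_empty_row (c : I → A) (a : I → J → A) {C : Finset J} (hC : C.Nonempty) :
    matchingSum c a ∅ C = 0 := by
  unfold matchingSum
  rw [prod_empty, coeff_one, if_neg]
  intro h
  obtain ⟨j, hj⟩ := hC
  have := DFunLike.congr_fun h j
  simp [indicatorExp_apply, hj] at this

/-- A matching covering `C` uses exactly one row at the column `j`. -/
theorem matchingSum_expand_col (c : I → A) (a : I → J → A) (R : Finset I) {C : Finset J} {j : J}
    (hj : j ∈ C) :
    matchingSum c a R C = ∑ i ∈ R, a i j * matchingSum c a (R.erase i) (C.erase j) := by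
  induction R using Finset.induction_on generalizing C with
  | empty => rw [sum_empty, matchingSum_empty_row c a ⟨j, hj⟩]
  | insert r R hr ih =>
    rw [matchingSum_insert_row c a hr, sum_insert hr, erase_insert hr, ih hj,
      ← add_sum_erase C _ hj]
    have h₁ : ∀ i ∈ R, a i j * matchingSum c a ((insert r R).erase i) (C.erase j) =
        c r * (a i j * matchingSum c a (R.erase i) (C.erase j)) +
          ∑ l ∈ C.erase j,
            a r l * (a i j * matchingSum c a (R.erase i) ((C.erase l).erase j)) := by
      intro i hi
      have hne : r ≠ i := fun h => hr (h ▸ hi)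
      rw [erase_insert_of_ne hne,
        matchingSum_insert_row c a (fun h => hr (mem_of_mem_erase h)), mul_add, mul_sum]
      congr 1
      · ring
      · refine sum_congr rfl fun l _ => ?_
        rw [erase_right_comm]
        ring
    have h₂ : ∀ l ∈ C.erase j, a r l * matchingSum c a R (C.erase l) =
        ∑ i ∈ R, a r l * (a i j * matchingSum c a (R.erase i) ((C.erase l).erase j)) := by
      intro l hl
      rw [ih (mem_erase.2 ⟨(ne_of_mem_erase hl).symm, hj⟩), mul_sum]
    rw [sum_congr rfl h₁, sum_congr rfl h₂, sum_add_distrib, mul_sum, sum_comm]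
    ring

/-- Submodularity of the matching sum in the set of rows. -/
theorem matchingSum_submodular (c : I → A) (a : I → J → A) {C : Finset J} {R S : Finset I} {i : I}
    (hS : S ⊆ R) (hi : i ∉ R) :
    AddLE (matchingSum c a (insert i R) C * matchingSum c a S C)
      (matchingSum c a R C * matchingSum c a (insert i S) C) := by
  induction C using Finset.strongInduction generalizing R S i with
  | H C ih =>
    -- After expansion along row `i` the `c i` terms agree, leaving this inequality. Expanding it
    -- along column `j`, the terms with `r ∈ S` follow by induction for `R.erase r` and `S.erase r`;
    -- those with `r ∈ R \ S` only enlarge the right side.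
    have key : ∀ j ∈ C, AddLE
        (matchingSum c a R (C.erase j) * matchingSum c a S C)
        (matchingSum c a R C * matchingSum c a S (C.erase j)) := by
      intro j hj
      rw [matchingSum_expand_col c a S hj, matchingSum_expand_col c a R hj, mul_sum, sum_mul]
      refine AddLE.trans (AddLE.sum S fun r hr => ?_) (AddLE.sum_subset hS _)
      have h := (ih (C.erase j) (erase_ssubset hj) (erase_subset_erase r hS)
        (notMem_erase r R)).mul_left (a r j)
      rw [insert_erase (hS hr), insert_erase hr] at h
      convert h using 1 <;> ring
    rw [matchingSum_insert_row c a hi, matchingSum_insert_row c a (fun h => hi (hS h)), add_mul,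
      mul_add, sum_mul, mul_sum]
    refine AddLE.add ?_ (AddLE.sum C fun j hj => ?_)
    · convert AddLE.refl _ using 1
      ring
    · convert (key j hj).mul_left (a i j) using 1 <;> ring

end Matching

/-! ### From the product of row sums to the permanent, one column at a time. -/

section Columns

variable {I J : Type*} [Fintype I] [Fintype J] [DecidableEq I] [DecidableEq J]

/-- The generic linear form of row `i` in the columns outside `C`. -/
noncomputable def freeForm (C : Finset J) (i : I) : MvPolynomial (I × J) ℕ :=
  ∑ j ∈ Cᶜ, X (i, j)

/-- The generating polynomial of the maps from rows to columns that hit every column of `C` exactly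
once. -/
noncomputable def hitOnce (I : Type*) [Fintype I] [DecidableEq I] (C : Finset J) :
    MvPolynomial (I × J) ℕ :=
  matchingSum (freeForm C) (fun i j => X (i, j)) univ C

/-- The generating polynomial of the maps from rows to columns that hit every column of `C` exactly
once and whose fibre over the column `j` is `T`. -/
noncomputable def hitOnceFibre (C : Finset J) (j : J) (T : Finset I) : MvPolynomial (I × J) ℕ :=
  (∏ i ∈ T, X (i, j)) * matchingSum (freeForm (insert j C)) (fun i j => X (i, j)) Tᶜ C

omit [Fintype I] [DecidableEq I] in
theorem freeForm_eq_add {C : Finset J} {j : J} (hj : j ∉ C) (i : I) :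
    freeForm C i = X (i, j) + freeForm (insert j C) i := by
  unfold freeForm
  have : Cᶜ = insert j (insert j C)ᶜ := by
    ext l
    simp only [mem_compl, mem_insert]
    by_cases h : l = j <;> simp [h, hj]
  rw [this, sum_insert (by simp)]

/-- Since `j` is free, each row's form splits as `X (i, j)` plus the rest; `T` records the rows
choosing `X (i, j)`. -/
theorem hitOnce_eq_sum_fibre {C : Finset J} {j : J} (hj : j ∉ C) :
    hitOnce I C = ∑ T : Finset I, hitOnceFibre C j T := by
  unfold hitOnce hitOnceFibre matchingSum
  simp_rw [freeForm_eq_add hj, map_add, add_assoc]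
  rw [Fintype.prod_add, coeff_sum]
  refine sum_congr rfl fun T _ => ?_
  rw [← map_prod, coeff_C_mul]

theorem hitOnce_insert {C : Finset J} {j : J} (hj : j ∉ C) :
    hitOnce I (insert j C) = ∑ i : I, hitOnceFibre C j {i} := by
  unfold hitOnce hitOnceFibre
  rw [matchingSum_expand_col _ _ _ (mem_insert_self j C), erase_insert hj]
  refine sum_congr rfl fun i _ => ?_
  rw [prod_singleton, compl_singleton]

theorem hitOnce_empty : hitOnce I (∅ : Finset J) = ∏ i : I, ∑ j : J, X (i, j) := by
  unfold hitOnce matchingSum freeForm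
  have : indicatorExp (∅ : Finset J) = 0 := by
    ext j
    simp [indicatorExp_apply]
  rw [this, ← constantCoeff_eq, map_prod]
  simp

theorem hitOnce_univ : hitOnce I (univ : Finset I) = ∑ σ : Equiv.Perm I, ∏ i, X (i, σ i) := by
  unfold hitOnce matchingSum freeForm
  simp only [compl_univ, sum_empty, map_zero, zero_add]
  rw [prod_univ_sum, coeff_sum, Fintype.piFinset_univ]
  have h : ∀ f : I → I, coeff (indicatorExp univ)
      (∏ i, (C (X (i, f i) : MvPolynomial (I × I) ℕ) * X (f i))) =
        if Function.Bijective f then ∏ i, X (i, f i) else 0 := by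
    intro f
    rw [prod_mul_distrib, ← map_prod, coeff_C_mul]
    have h₁ : (∏ i, X (f i) : MvPolynomial I (MvPolynomial (I × I) ℕ)) =
        monomial (∑ i, Finsupp.single (f i) 1) 1 := by
      rw [monomial_sum_one]
      rfl
    have h₂ : (∑ i, Finsupp.single (f i) 1 = indicatorExp univ) ↔ Function.Bijective f := by
      constructor
      · intro h
        refine (Finite.surjective_iff_bijective).1 fun j => ?_
        have := DFunLike.congr_fun h j
        by_contra hj
        push Not at hj
        simp [indicatorExp_apply, Finsupp.finsetSum_apply, hj] at this
      · intro h
        ext j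
        obtain ⟨i, rfl⟩ := h.2 j
        simp [indicatorExp_apply, Finsupp.finsetSum_apply, Finsupp.single_apply, h.1.eq_iff]
    rw [h₁, coeff_monomial]
    simp only [h₂]
    split_ifs <;> simp
  rw [sum_congr rfl fun f _ => h f, ← sum_filter]
  symm
  refine sum_bij (fun σ _ => σ) (fun σ _ => by simp)
    (fun σ _ τ _ h => DFunLike.coe_injective h) (fun f hf => ?_) (fun σ _ => rfl)
  exact ⟨Equiv.ofBijective f (mem_filter.1 hf).2, mem_univ _, rfl⟩

/-- Submodularity for the row sets `Tᶜ ⊆ {i}ᶜ`; the monomials in column `j` are the same on both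
sides. -/
theorem hitOnceFibre_exchange (C : Finset J) (j : J) {T : Finset I} {i : I} (hi : i ∈ T) :
    AddLE (hitOnceFibre C j ∅ * hitOnceFibre C j T)
      (hitOnceFibre C j {i} * hitOnceFibre C j (T.erase i)) := by
  unfold hitOnceFibre
  have h := matchingSum_submodular (freeForm (insert j C))
    (fun (i : I) (j : J) => (X (i, j) : MvPolynomial (I × J) ℕ)) (C := C) (R := {i}ᶜ) (S := Tᶜ)
    (i := i) (by simpa using hi) (by simp)
  have h₁ : insert i ({i}ᶜ : Finset I) = ∅ᶜ := by
    ext l; simp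
  have h₂ : insert i Tᶜ = (T.erase i)ᶜ := by
    ext l; simp only [mem_insert, mem_compl, mem_erase]; tauto
  rw [h₁, h₂] at h
  rw [← mul_prod_erase T _ hi, prod_empty, prod_singleton]
  convert h.mul_left (X (i, j) * ∏ x ∈ T.erase i, X (x, j)) using 1 <;> ring

/-- Exchanges turn fibres of average size one into singletons, each exchange splitting off one
singleton that is then set aside. -/
theorem hitOnceFibre_multiset_prod (C : Finset J) (j : J) (S : Multiset (Finset I))
    (hS : (S.map card).sum = S.card) :
    AddLE (S.map (hitOnceFibre C j)).prod
      ((S.bind Finset.val).map fun i => hitOnceFibre C j {i}).prod := by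
  induction hn : S.card generalizing S with
  | zero =>
    rw [Multiset.card_eq_zero] at hn
    subst hn
    simpa using AddLE.refl _
  | succ n ih =>
    by_cases h₁ : ∃ i : I, {i} ∈ S
    · obtain ⟨i, hi⟩ := h₁
      obtain ⟨S, rfl⟩ := Multiset.exists_cons_of_mem hi
      simp only [Multiset.map_cons, Multiset.sum_cons, Multiset.card_cons, card_singleton,
        Multiset.prod_cons, Multiset.cons_bind, Multiset.map_add, Multiset.prod_add,
        singleton_val, Multiset.map_singleton, Multiset.prod_singleton] at hS hn ⊢
      exact (ih S (by omega) (by omega)).mul_left _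
    have h₁' : ∀ T ∈ S, T.card ≠ 1 := fun T hT h => by
      obtain ⟨i, rfl⟩ := card_eq_one.1 h
      exact h₁ ⟨i, hT⟩
    -- Without singletons or `∅`, all sizes would be at least two, against average size one.
    have h₀ : ∅ ∈ S := by
      by_contra h₀
      have : S.card • 2 ≤ (S.map card).sum := by
        rw [← Multiset.card_map card S]
        refine Multiset.card_nsmul_le_sum fun x hx => ?_
        obtain ⟨T, hT, rfl⟩ := Multiset.mem_map.1 hx
        have := h₁' T hT
        have : T.card ≠ 0 := fun h => h₀ (card_eq_zero.1 h ▸ hT)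
        omega
      rw [smul_eq_mul] at this
      omega
    obtain ⟨S, rfl⟩ := Multiset.exists_cons_of_mem h₀
    have h₂ : ∃ T ∈ S, T.Nonempty := by
      by_contra! h₂
      have : (S.map card).sum = 0 := Multiset.sum_eq_zero fun x hx => by
        obtain ⟨T, hT, rfl⟩ := Multiset.mem_map.1 hx
        rw [h₂ T hT, card_empty]
      simp at hS hn
      omega
    obtain ⟨T, hT, i, hi⟩ := h₂
    obtain ⟨S, rfl⟩ := Multiset.exists_cons_of_mem hT
    have hcard := card_erase_add_one hi
    have hval : T.val = i ::ₘ (T.erase i).val := by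
      rw [erase_val, Multiset.cons_erase hi]
    have := ih (T.erase i ::ₘ S) (by simp at hS ⊢; omega) (by simp at hn ⊢; omega)
    simp only [Multiset.map_cons, Multiset.prod_cons, Multiset.cons_bind, empty_val, zero_add,
      hval, Multiset.cons_add] at this ⊢
    refine AddLE.trans ?_ (this.mul_left _)
    rw [← mul_assoc, ← mul_assoc]
    exact (hitOnceFibre_exchange C j hi).mul_right _

omit [Fintype I] in
theorem matchingSum_mem_supported (s : Set (I × J)) (c : I → MvPolynomial (I × J) ℕ)
    (a : I → J → MvPolynomial (I × J) ℕ) (R : Finset I) (C : Finset J)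
    (hc : ∀ i, c i ∈ supported ℕ s) (ha : ∀ i, ∀ j ∈ C, a i j ∈ supported ℕ s) :
    matchingSum c a R C ∈ supported ℕ s := by
  induction R using Finset.induction_on generalizing C with
  | empty =>
    obtain rfl | hC := C.eq_empty_or_nonempty
    · unfold matchingSum
      have : indicatorExp (∅ : Finset J) = 0 := by
        ext j
        simp [indicatorExp_apply]
      rw [this, prod_empty, coeff_zero_one]
      exact one_mem _
    · rw [matchingSum_empty_row _ _ hC]
      exact zero_mem _
  | insert i R hi ih =>
    rw [matchingSum_insert_row _ _ hi]
    refine add_mem (mul_mem (hc i) (ih C ha)) (sum_mem fun j hj => mul_mem (ha i j hj) (ih _ ?_))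
    exact fun i l hl => ha i l (mem_of_mem_erase hl)

theorem coeff_monomial_mul_eq_zero {σ : Type*} {d k : σ →₀ ℕ} {Q : MvPolynomial σ ℕ} {s : Set σ}
    (hQ : Q ∈ supported ℕ s) {x : σ} (hx : x ∉ s) (h : k x ≠ d x) :
    coeff k (monomial d 1 * Q) = 0 := by
  classical
  rw [coeff_monomial_mul']
  split_ifs with hd
  · rw [one_mul]
    by_contra hne
    refine hx (mem_supported.1 hQ ?_)
    refine (mem_vars_iff_mem_support x).2 ⟨k - d, mem_support_iff.2 hne, ?_⟩
    rw [Finsupp.mem_support_iff, Finsupp.tsub_apply]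
    have := hd x
    omega
  · rfl

/-- The matching sums involve no variable of column `j`, so the exponent of `X (i, j)` is the number
of fibres containing `i`. -/
theorem coeff_prod_hitOnceFibre_eq_zero {M : ℕ} {C : Finset J} {j : J} (hj : j ∉ C)
    (T : Fin M → Finset I) (k : I × J →₀ ℕ) {i : I}
    (h : #{l | i ∈ T l} ≠ k (i, j)) :
    coeff k (∏ l, hitOnceFibre C j (T l)) = 0 := by
  unfold hitOnceFibre
  rw [prod_mul_distrib]
  have h₁ : ∏ l, ∏ i ∈ T l, (X (i, j) : MvPolynomial (I × J) ℕ) =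
      monomial (∑ l, ∑ i ∈ T l, Finsupp.single (i, j) 1) 1 := by
    simp_rw [monomial_sum_one]
    rfl
  rw [h₁]
  refine coeff_monomial_mul_eq_zero (s := {x | x.2 ≠ j}) (x := (i, j)) ?_ (by simp) ?_
  · refine prod_mem fun l _ => matchingSum_mem_supported _ _ _ _ _ (fun r => ?_) ?_
    · refine sum_mem fun c hc => X_mem_supported.2 ?_
      rintro rfl
      simp at hc
    · intro r c hc
      refine X_mem_supported.2 ?_
      rintro rfl
      exact hj hc
  · refine fun h' => h ?_
    rw [h']
    rw [card_filter]
    simp [Finsupp.finsetSum_apply, Finsupp.single_apply, -sum_boole]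

/-- A tuple `T` is determined by the index sets `{l | i ∈ T l}`, one of size `k i` for each `i`. -/
theorem card_fibre_counts_le (M : ℕ) (k : I → ℕ) :
    #{T : Fin M → Finset I | ∀ i, #{l | i ∈ T l} = k i} ≤ ∏ i, M.choose (k i) := by
  have : ∏ i, M.choose (k i) =
      #(Fintype.piFinset fun i => powersetCard (k i) (univ : Finset (Fin M))) := by
    simp [Fintype.card_piFinset]
  rw [this]
  refine card_le_card_of_injOn (fun T i => ({l | i ∈ T l} : Finset (Fin M))) ?_ ?_
  · intro T hT
    simpa [mem_powersetCard] using hT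
  · intro T _ T' _ h
    funext l
    ext i
    have := congrArg (l ∈ ·) (congrFun h i)
    simpa using this

/-- Passing from columns whose fibres are merely of the right total size to a column hit exactly
once in each of `M` copies. -/
theorem coeff_hitOnce_pow_mul_multinomial_le {M : ℕ} {C : Finset J} {j : J} (hj : j ∉ C)
    (k : I × J →₀ ℕ) (hk : ∑ i, k (i, j) = M) :
    coeff k (hitOnce I C ^ M) * Nat.multinomial univ (fun i => k (i, j)) ≤
      coeff k (hitOnce I (insert j C) ^ M) * ∏ i, M.choose (k (i, j)) := by
  set P : MvPolynomial (I × J) ℕ := ∏ i, hitOnceFibre C j {i} ^ k (i, j) with hP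
  have lower : Nat.multinomial univ (fun i => k (i, j)) * coeff k P ≤
      coeff k (hitOnce I (insert j C) ^ M) := by
    rw [hitOnce_insert hj, sum_pow_eq_sum_piAntidiag, coeff_sum]
    have hmem : (fun i => k (i, j)) ∈ piAntidiag (univ : Finset I) M := by
      simp [mem_piAntidiag, hk]
    refine le_trans (le_of_eq ?_) (single_le_sum (fun _ _ => Nat.zero_le _) hmem)
    rw [← map_natCast (MvPolynomial.C : ℕ →+* MvPolynomial (I × J) ℕ), coeff_C_mul]
    rfl
  have upper : coeff k (hitOnce I C ^ M) ≤ (∏ i, M.choose (k (i, j))) * coeff k P := by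
    rw [hitOnce_eq_sum_fibre hj, Fintype.sum_pow, coeff_sum,
      ← sum_filter_add_sum_filter_not univ
        (fun T : Fin M → Finset I => ∀ i, #{l | i ∈ T l} = k (i, j))]
    rw [sum_eq_zero (s := univ.filter fun T : Fin M → Finset I =>
      ¬ ∀ i, #{l | i ∈ T l} = k (i, j)), add_zero]
    · refine le_trans (sum_le_card_nsmul _ _ (coeff k P) fun T hT => ?_) ?_
      · have hT : ∀ i, #{l | i ∈ T l} = k (i, j) := (mem_filter.1 hT).2
        have h := hitOnceFibre_multiset_prod C j ((univ : Finset (Fin M)).val.map T) ?_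
        · have h' := h.coeff_le k
          rw [Multiset.map_map] at h'
          refine h'.trans (le_of_eq (congrArg (coeff k) ?_))
          · rw [hP, prod_multiset_map_count, prod_subset (subset_univ _)]
            · refine prod_congr rfl fun i _ => ?_
              congr 1
              rw [← hT i, Multiset.count_bind, Multiset.map_map, card_filter]
              refine sum_congr rfl fun l _ => ?_
              exact Multiset.count_eq_of_nodup (T l).nodup
            · intro i _ hi
              rw [Multiset.mem_toFinset] at hi
              rw [Multiset.count_eq_zero_of_notMem hi, pow_zero]
        · rw [Multiset.map_map, Multiset.card_map]
          change ∑ l, #(T l) = #univ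
          refine Eq.trans ?_ (hk.trans (Fintype.card_fin M).symm)
          simp_rw [← hT, card_filter]
          rw [sum_comm]
          simp
      · rw [smul_eq_mul]
        exact Nat.mul_le_mul_right _ (card_fibre_counts_le M _)
    · intro T hT
      obtain ⟨i, hi⟩ := not_forall.1 (mem_filter.1 hT).2
      exact coeff_prod_hitOnceFibre_eq_zero hj T k hi
  calc _ ≤ (∏ i, M.choose (k (i, j))) * coeff k P * Nat.multinomial univ (fun i => k (i, j)) :=
        Nat.mul_le_mul_right _ upper
    _ = (Nat.multinomial univ (fun i => k (i, j)) * coeff k P) * ∏ i, M.choose (k (i, j)) := by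
        ring
    _ ≤ _ := Nat.mul_le_mul_right _ lower

theorem coeff_hitOnce_empty_pow_le {M : ℕ} (k : I × J →₀ ℕ) (hk : ∀ j, ∑ i, k (i, j) = M)
    (C : Finset J) :
    coeff k (hitOnce I (∅ : Finset J) ^ M) *
        ∏ j ∈ C, Nat.multinomial univ (fun i => k (i, j)) ≤
      coeff k (hitOnce I C ^ M) * ∏ j ∈ C, ∏ i, M.choose (k (i, j)) := by
  induction C using Finset.induction_on with
  | empty => simp
  | insert j C hj ih =>
    rw [prod_insert hj, prod_insert hj]
    have h := coeff_hitOnce_pow_mul_multinomial_le hj k (hk j)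
    calc _ = (coeff k (hitOnce I (∅ : Finset J) ^ M) *
          ∏ j ∈ C, Nat.multinomial univ (fun i => k (i, j))) *
            Nat.multinomial univ (fun i => k (i, j)) := by ring
      _ ≤ (coeff k (hitOnce I C ^ M) * ∏ j ∈ C, ∏ i, M.choose (k (i, j))) *
            Nat.multinomial univ (fun i => k (i, j)) := Nat.mul_le_mul_right _ ih
      _ = (coeff k (hitOnce I C ^ M) * Nat.multinomial univ (fun i => k (i, j))) *
            ∏ j ∈ C, ∏ i, M.choose (k (i, j)) := by ring
      _ ≤ (coeff k (hitOnce I (insert j C) ^ M) * ∏ i, M.choose (k (i, j))) *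
            ∏ j ∈ C, ∏ i, M.choose (k (i, j)) := Nat.mul_le_mul_right _ h
      _ = _ := by ring

end Columns

/-! ### Counting permutations with prescribed values, and monomials by their exponents. -/

theorem card_perm_fixing {α : Type*} [Fintype α] [DecidableEq α] (S : Finset α) :
    #{σ : Equiv.Perm α | ∀ l ∈ S, σ l = l} = (Fintype.card α - #S)! := by
  rw [← Fintype.card_subtype]
  have e := Equiv.Perm.subtypeEquivSubtypePerm (fun a : α => a ∉ S)
  have h := Fintype.card_congr e
  simp only [not_not] at h
  rw [← h, Fintype.card_perm, Fintype.card_subtype_compl, Fintype.card_coe]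

/-- Composing with the inverse of one solution `τ` gives permutations fixing `S` pointwise. -/
theorem card_perm_extending_le {α : Type*} [Fintype α] [DecidableEq α] (S : Finset α)
    (g : α → α) :
    #{σ : Equiv.Perm α | ∀ l ∈ S, σ (g l) = l} ≤ (Fintype.card α - #S)! := by
  obtain h | ⟨τ, hτ⟩ :=
    (univ.filter fun σ : Equiv.Perm α => ∀ l ∈ S, σ (g l) = l).eq_empty_or_nonempty
  · rw [h, card_empty]
    exact Nat.zero_le _
  · rw [← card_perm_fixing S]
    refine card_le_card_of_injOn (fun σ => σ * τ⁻¹) ?_ fun σ _ σ' _ h => mul_right_cancel h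
    intro σ hσ
    simp only [coe_filter, mem_univ, true_and, Set.mem_ofPred_eq, mem_filter] at hσ hτ ⊢
    intro l hl
    rw [Equiv.Perm.mul_apply]
    nth_rw 1 [← hτ l hl]
    rw [Equiv.Perm.inv_def, Equiv.symm_apply_apply, hσ l hl]

/-- The exponent vector counting, for a map assigning a column to each copy of each row, how often
each entry is used. -/
noncomputable def usage {I J : Type*} {M : ℕ} [Fintype I] (f : I × Fin M → J) : I × J →₀ ℕ :=
  ∑ a, Finsupp.single (a.1, f a) 1

section Usage

variable {I J : Type*} {M : ℕ} [Fintype I] [DecidableEq I] [DecidableEq J]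

theorem usage_apply (f : I × Fin M → J) (i : I) (j : J) :
    usage f (i, j) = #{l | f (i, l) = j} := by
  unfold usage
  rw [Finsupp.finsetSum_apply, card_filter, Fintype.sum_prod_type, sum_eq_single i]
  · simp [Finsupp.single_apply, -sum_boole]
  · intro r _ hr
    simp [hr]
  · simp

theorem sum_usage (f : I × Fin M → J) (j : J) : ∑ i, usage f (i, j) = #{a | f a = j} := by
  simp_rw [usage_apply, card_filter]
  rw [Fintype.sum_prod_type]

theorem hitOnce_empty_pow [Fintype J] :
    hitOnce I (∅ : Finset J) ^ M = ∑ f : I × Fin M → J, monomial (usage f) 1 := by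
  rw [hitOnce_empty, ← prod_pow]
  have : ∀ i : I, (∑ j : J, X (i, j) : MvPolynomial (I × J) ℕ) ^ M =
      ∏ _l : Fin M, ∑ j : J, X (i, j) := by simp
  simp_rw [this]
  rw [← Fintype.prod_prod_type (f := fun a : I × Fin M =>
    (∑ j : J, X (a.1, j) : MvPolynomial (I × J) ℕ)), Fintype.prod_sum]
  refine sum_congr rfl fun f _ => ?_
  unfold usage
  rw [monomial_sum_one]
  rfl

theorem coeff_hitOnce_empty_pow [Fintype J] (k : I × J →₀ ℕ) :
    coeff k (hitOnce I (∅ : Finset J) ^ M) = #{f : I × Fin M → J | usage f = k} := by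
  rw [hitOnce_empty_pow, coeff_sum, card_filter]
  simp only [coeff_monomial]

/-- Two solutions differ by a permutation preserving the first coordinate; these form a group of
order `M ! ^ Fintype.card I`. -/
theorem card_perm_fst_le (f : I × Fin M → I) :
    #{τ : Equiv.Perm (I × Fin M) | ∀ a, (τ a).1 = f a} ≤ M ! ^ Fintype.card I := by
  obtain h | ⟨τ, hτ⟩ :=
    (univ.filter fun τ : Equiv.Perm (I × Fin M) => ∀ a, (τ a).1 = f a).eq_empty_or_nonempty
  · rw [h, card_empty]
    exact Nat.zero_le _
  · have hM : ∀ i : I, Fintype.card {a : I × Fin M // a.1 = i} = M := by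
      intro i
      rw [Fintype.card_subtype, card_filter, Fintype.sum_prod_type_right]
      simp
    have hs := DomMulAct.stabilizer_card (Prod.fst : I × Fin M → I)
    simp_rw [hM] at hs
    rw [prod_const, card_univ, Fintype.card_subtype] at hs
    rw [← hs]
    refine card_le_card_of_injOn (fun σ => σ * τ⁻¹) ?_ fun σ _ σ' _ h => mul_right_cancel h
    intro σ hσ
    simp only [coe_filter, mem_univ, true_and, Set.mem_ofPred_eq, mem_filter] at hσ hτ ⊢
    funext a
    rw [Function.comp_apply, Equiv.Perm.mul_apply, hσ, ← hτ,
      Equiv.Perm.inv_def, Equiv.apply_symm_apply]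

theorem sum_usage_fst_perm (τ : Equiv.Perm (I × Fin M)) (i : I) :
    ∑ r, usage (fun a => (τ a).1) (r, i) = M := by
  rw [sum_usage, card_filter, Equiv.sum_comp τ fun a => if a.1 = i then 1 else 0,
    Fintype.sum_prod_type_right]
  simp

end Usage

/-! ### The average over lifts and its comparison with the permanent. -/

section Lift

variable {m M : ℕ}

theorem ofPerms_injective : Function.Injective (ofPerms (m := m) (M := M)) := by
  intro s t h
  funext i j
  ext1 k
  have := congrFun (congrFun h (i, k)) (j, t i j k)
  by_contra hne
  simp [ofPerms, PEquiv.toMatrix_apply, hne] at this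

theorem blockPermutationMatrices_toFinset :
    (blockPermutationMatrices_finite m M).toFinset =
      univ.map ⟨ofPerms (m := m) (M := M), ofPerms_injective⟩ := by
  ext P
  simp [blockPermutationMatrices_eq_range]

theorem lifting_ofPerms_apply (θ : Matrix (Fin m) (Fin m) ℝ)
    (s : Fin m → Fin m → Equiv.Perm (Fin M)) (a b : Fin m × Fin M) :
    lifting θ (ofPerms s) a b = θ a.1 b.1 * if s a.1 b.1 a.2 = b.2 then 1 else 0 := by
  simp [lifting, block, ofPerms, PEquiv.toMatrix_apply]

theorem card_compatible_le (τ : Equiv.Perm (Fin m × Fin M)) :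
    #{s : Fin m → Fin m → Equiv.Perm (Fin M) | ∀ a, s (τ a).1 a.1 (τ a).2 = a.2} ≤
      ∏ x : Fin m × Fin m, (M - usage (fun a => (τ a).1) x)! := by
  -- The conditions on different blocks are independent: block `(i, j)` has one prescribed value for
  -- each `l` with `(τ (j, l)).1 = i`.
  have h : (univ.filter fun s : Fin m → Fin m → Equiv.Perm (Fin M) =>
      ∀ a, s (τ a).1 a.1 (τ a).2 = a.2) ⊆
      Fintype.piFinset fun i => Fintype.piFinset fun j =>
        univ.filter fun σ : Equiv.Perm (Fin M) =>
          ∀ l ∈ univ.filter fun l => (τ (j, l)).1 = i, σ (τ (j, l)).2 = l := by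
    intro s hs
    simp only [Fintype.mem_piFinset, mem_filter, mem_univ, true_and] at hs ⊢
    rintro i j l rfl
    exact hs (j, l)
  refine (card_le_card h).trans ?_
  rw [Fintype.card_piFinset, Fintype.prod_prod_type_right]
  refine prod_le_prod' fun i _ => ?_
  rw [Fintype.card_piFinset]
  refine prod_le_prod' fun j _ => ?_
  have h := card_perm_extending_le (univ.filter fun l => (τ (j, l)).1 = i) fun l => (τ (j, l)).2
  rw [Fintype.card_fin] at h
  rw [usage_apply]
  refine le_trans (le_of_eq ?_) h
  congr!

theorem permanent_lifting_ofPerms (θ : Matrix (Fin m) (Fin m) ℝ)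
    (s : Fin m → Fin m → Equiv.Perm (Fin M)) :
    (lifting θ (ofPerms s)).permanent = ∑ τ : Equiv.Perm (Fin m × Fin M),
      (∏ a, θ (τ a).1 a.1) * if ∀ a, s (τ a).1 a.1 (τ a).2 = a.2 then 1 else 0 := by
  unfold Matrix.permanent
  refine sum_congr rfl fun τ _ => ?_
  simp_rw [lifting_ofPerms_apply]
  rw [prod_mul_distrib, prod_boole]
  simp

/-- The permanents of all lifts, bounded by a sum over the assignments of block rows to columns. -/
theorem sum_permanent_lifting_le {θ : Matrix (Fin m) (Fin m) ℝ} (hθ : ∀ i j, 0 ≤ θ i j) :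
    ∑ s : Fin m → Fin m → Equiv.Perm (Fin M), (lifting θ (ofPerms s)).permanent ≤
      ∑ f : Fin m × Fin M → Fin m with ∀ i, ∑ r, usage f (r, i) = M,
        (M ! : ℝ) ^ m * ((∏ a, θ (f a) a.1) * ∏ x, ((M - usage f x)! : ℝ)) := by
  simp_rw [permanent_lifting_ofPerms]
  rw [sum_comm]
  calc _ ≤ ∑ τ : Equiv.Perm (Fin m × Fin M), (∏ a, θ (τ a).1 a.1) *
          ∏ x, ((M - usage (fun a => (τ a).1) x)! : ℝ) := by
        refine sum_le_sum fun τ _ => ?_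
        rw [← mul_sum, sum_boole]
        refine mul_le_mul_of_nonneg_left ?_ (prod_nonneg fun a _ => hθ _ _)
        exact_mod_cast card_compatible_le τ
    _ = ∑ f : Fin m × Fin M → Fin m with ∀ i, ∑ r, usage f (r, i) = M,
          ∑ τ : Equiv.Perm (Fin m × Fin M) with (fun a => (τ a).1) = f,
            (∏ a, θ (τ a).1 a.1) * ∏ x, ((M - usage (fun a => (τ a).1) x)! : ℝ) := by
        symm
        refine sum_fiberwise_of_maps_to (fun τ _ => ?_) _
        simp only [mem_filter, mem_univ, true_and]
        exact sum_usage_fst_perm τ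
    _ ≤ _ := by
        refine sum_le_sum fun f _ => ?_
        refine (sum_le_card_nsmul _ _
          ((∏ a, θ (f a) a.1) * ∏ x, ((M - usage f x)! : ℝ)) ?_).trans ?_
        · intro τ hτ
          obtain rfl := (mem_filter.1 hτ).2
          exact le_rfl
        · rw [nsmul_eq_mul]
          refine mul_le_mul_of_nonneg_right ?_
            (mul_nonneg (prod_nonneg fun a _ => hθ _ _) (prod_nonneg fun x _ => Nat.cast_nonneg _))
          have := card_perm_fst_le f
          rw [Fintype.card_fin] at this
          simp_rw [funext_iff]
          exact_mod_cast this

theorem card_blockPermutationMatrices :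
    ((blockPermutationMatrices_finite m M).toFinset.card : ℝ) =
      ∏ _x : Fin m × Fin m, (M ! : ℝ) := by
  rw [blockPermutationMatrices_toFinset, card_map, card_univ]
  simp [Fintype.card_perm, pow_mul]

/-- For balanced exponents, the weight in the average over lifts is the quotient of multinomial by
binomial coefficients. -/
theorem factorial_weight_eq (k : Fin m × Fin m → ℕ) (hk : ∀ i, ∑ r, k (r, i) = M) :
    (M ! : ℝ) ^ m * ∏ x, ((M - k x)! : ℝ) =
      (∏ _x : Fin m × Fin m, (M ! : ℝ)) *
        ((∏ i, (Nat.multinomial univ (fun r => k (r, i)) : ℝ)) /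
          ∏ i, ∏ r, (M.choose (k (r, i)) : ℝ)) := by
  have hle : ∀ r i, k (r, i) ≤ M := fun r i =>
    (single_le_sum (f := fun r => k (r, i)) (fun _ _ => Nat.zero_le _) (mem_univ r)).trans_eq (hk i)
  have h₁ : ∀ i, (Nat.multinomial univ (fun r => k (r, i)) : ℝ) * ∏ r, ((k (r, i))! : ℝ) = M ! := by
    intro i
    have := Nat.multinomial_spec univ fun r => k (r, i)
    rw [hk i] at this
    rw [mul_comm]
    exact_mod_cast this
  have h₂ : ∀ i r, (M ! : ℝ) = M.choose (k (r, i)) * (k (r, i))! * (M - k (r, i))! := by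
    intro i r
    exact_mod_cast (Nat.choose_mul_factorial_mul_factorial (hle r i)).symm
  have h₃ : (M ! : ℝ) ^ m = ∏ _i : Fin m, (M ! : ℝ) := by simp
  rw [Fintype.prod_prod_type_right, Fintype.prod_prod_type_right, h₃, ← prod_mul_distrib,
    ← prod_div_distrib, ← prod_mul_distrib]
  refine prod_congr rfl fun i _ => ?_
  have h₄ : (∏ r, (M.choose (k (r, i)) : ℝ)) ≠ 0 :=
    prod_ne_zero_iff.2 fun r _ => Nat.cast_ne_zero.2 (Nat.choose_pos (hle r i)).ne'
  rw [prod_congr rfl fun r _ => h₂ i r, prod_mul_distrib, prod_mul_distrib, ← h₁ i]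
  field_simp

/-- The average permanent of a lift as a sum over balanced assignments. -/
theorem averageLiftPermanent_le {θ : Matrix (Fin m) (Fin m) ℝ} (hθ : ∀ i j, 0 ≤ θ i j) :
    averageLiftPermanent M θ ≤
      ∑ f : Fin m × Fin M → Fin m with ∀ i, ∑ r, usage f (r, i) = M,
        (∏ a, θ (f a) a.1) * ((∏ i, (Nat.multinomial univ (fun r => usage f (r, i)) : ℝ)) /
          ∏ i, ∏ r, (M.choose (usage f (r, i)) : ℝ)) := by
  unfold averageLiftPermanent
  have hpos : (0 : ℝ) < ∏ _x : Fin m × Fin m, (M ! : ℝ) :=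
    prod_pos fun _ _ => Nat.cast_pos.2 (Nat.factorial_pos M)
  rw [card_blockPermutationMatrices, div_le_iff₀ hpos, blockPermutationMatrices_toFinset, sum_map]
  refine (sum_permanent_lifting_le hθ).trans_eq ?_
  rw [sum_mul]
  refine sum_congr rfl fun f hf => ?_
  rw [mul_left_comm, factorial_weight_eq _ (mem_filter.1 hf).2]
  ring

theorem averageLiftPermanent_nonneg {θ : Matrix (Fin m) (Fin m) ℝ} (hθ : ∀ i j, 0 ≤ θ i j) :
    0 ≤ averageLiftPermanent M θ := by
  unfold averageLiftPermanent
  rw [blockPermutationMatrices_toFinset, sum_map]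
  refine div_nonneg (sum_nonneg fun s _ => ?_) (Nat.cast_nonneg _)
  rw [Function.Embedding.coeFn_mk, permanent_lifting_ofPerms]
  refine sum_nonneg fun τ _ => mul_nonneg (prod_nonneg fun a _ => hθ _ _) ?_
  split_ifs <;> norm_num

/-- The transpose appears because `Matrix.permanent` applies the permutation to the row index, so
the rows of the generic matrix correspond to columns of `θ`. -/
theorem aeval_hitOnce_univ (θ : Matrix (Fin m) (Fin m) ℝ) :
    aeval (fun x : Fin m × Fin m => θ x.2 x.1) (hitOnce (Fin m) (univ : Finset (Fin m))) =
      θ.permanent := by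
  rw [hitOnce_univ, map_sum]
  simp [Matrix.permanent]

theorem sum_coeff_mul_le_aeval {σ : Type*} [DecidableEq σ] (Q : MvPolynomial σ ℕ)
    (K : Finset (σ →₀ ℕ)) {v : σ → ℝ} (hv : ∀ x, 0 ≤ v x) :
    ∑ k ∈ K, ((coeff k Q : ℕ) : ℝ) * k.prod (fun x n => v x ^ n) ≤ aeval v Q := by
  have h : aeval v Q = ∑ k ∈ Q.support, ((coeff k Q : ℕ) : ℝ) * k.prod (fun x n => v x ^ n) := by
    rw [aeval_def, eval₂_eq]
    rfl
  rw [h]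
  refine (sum_le_sum_of_subset_of_nonneg (subset_union_left (s₂ := Q.support))
    fun k _ _ => mul_nonneg (Nat.cast_nonneg _) (prod_nonneg fun x _ => pow_nonneg (hv x) _)).trans
    (le_of_eq ?_)
  symm
  refine sum_subset subset_union_right fun k _ hk => ?_
  rw [notMem_support_iff.1 hk, Nat.cast_zero, zero_mul]

theorem averageLiftPermanent_le_permanent_pow {θ : Matrix (Fin m) (Fin m) ℝ}
    (hθ : ∀ i j, 0 ≤ θ i j) : averageLiftPermanent M θ ≤ θ.permanent ^ M := by
  refine (averageLiftPermanent_le hθ).trans ?_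
  set v : Fin m × Fin m → ℝ := fun x => θ x.2 x.1
  set K : Finset (Fin m × Fin m →₀ ℕ) :=
    (univ.filter fun f : Fin m × Fin M → Fin m => ∀ i, ∑ r, usage f (r, i) = M).image usage with hK
  have hbal : ∀ k ∈ K, ∀ i, ∑ r, k (r, i) = M := by
    intro k hk
    obtain ⟨f, hf, rfl⟩ := mem_image.1 hk
    exact (mem_filter.1 hf).2
  rw [← aeval_hitOnce_univ, ← map_pow]
  refine le_trans ?_ (sum_coeff_mul_le_aeval _ K fun x => hθ x.2 x.1)
  -- Both the weight and the monomial depend on `f` only through `usage f`, so the comparison is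
  -- made for each exponent `k`.
  rw [← sum_fiberwise_of_maps_to (t := K) (g := usage) fun f hf => mem_image_of_mem _ hf]
  refine sum_le_sum fun k hk => ?_
  set W : ℝ := (∏ i, (Nat.multinomial univ (fun r => k (r, i)) : ℝ)) /
          ∏ i, ∏ r, (M.choose (k (r, i)) : ℝ) with hW
  have hprod : ∀ f : Fin m × Fin M → Fin m,
      ∏ a, θ (f a) a.1 = (usage f).prod fun x n => v x ^ n := by
    intro f
    have h : aeval v (monomial (usage f) 1 : MvPolynomial (Fin m × Fin m) ℕ) =
        ∏ a, θ (f a) a.1 := by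
      unfold usage
      rw [monomial_sum_one, map_prod]
      refine prod_congr rfl fun a _ => ?_
      exact aeval_X v (a.1, f a)
    rw [← h, aeval_monomial, map_one, one_mul]
  have hnonneg : 0 ≤ k.prod fun x n => v x ^ n :=
    prod_nonneg fun x _ => pow_nonneg (hθ x.2 x.1) _
  have hWnonneg : 0 ≤ W := by positivity
  have hle : ∀ r i, k (r, i) ≤ M := fun r i =>
    (single_le_sum (f := fun r => k (r, i)) (fun _ _ => Nat.zero_le _) (mem_univ r)).trans_eq
      (hbal k hk i)
  have hpos : (0 : ℝ) < ∏ i, ∏ r, (M.choose (k (r, i)) : ℝ) :=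
    prod_pos fun i _ => prod_pos fun r _ => Nat.cast_pos.2 (Nat.choose_pos (hle r i))
  -- The column-by-column bound, carried from `C = ∅` to `C = univ`.
  have hmain : (#{f : Fin m × Fin M → Fin m | usage f = k} : ℝ) * W ≤
      coeff k (hitOnce (Fin m) (univ : Finset (Fin m)) ^ M) := by
    rw [hW, ← mul_div_assoc, div_le_iff₀ hpos, ← coeff_hitOnce_empty_pow]
    exact_mod_cast coeff_hitOnce_empty_pow_le k (hbal k hk) univ
  refine (sum_le_card_nsmul _ _ ((k.prod fun x n => v x ^ n) * W) fun f hf => ?_).trans ?_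
  · obtain rfl := (mem_filter.1 hf).2
    rw [hprod]
  · rw [nsmul_eq_mul]
    calc _ ≤ (#{f : Fin m × Fin M → Fin m | usage f = k} : ℝ) *
          ((k.prod fun x n => v x ^ n) * W) := by
          refine mul_le_mul_of_nonneg_right ?_ (mul_nonneg hnonneg hWnonneg)
          exact_mod_cast card_le_card (filter_subset_filter _ (filter_subset _ _))
      _ = ((#{f : Fin m × Fin M → Fin m | usage f = k} : ℝ) * W) *
          (k.prod fun x n => v x ^ n) := by ring
      _ ≤ _ := mul_le_mul_of_nonneg_right hmain hnonneg

end Lift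

end BethePermanent

theorem theorem2 (m M : ℕ) (hM : 1 ≤ M) (θ : Matrix (Fin m) (Fin m) ℝ)
    (hθ : ∀ i j, 0 ≤ θ i j) :
    BethePermanent.bethePermanent M θ ≤ θ.permanent := by
  have hperm : 0 ≤ θ.permanent := sum_nonneg fun σ _ => prod_nonneg fun i _ => hθ _ _
  unfold BethePermanent.bethePermanent
  calc _ ≤ (θ.permanent ^ M) ^ (1 / (M : ℝ)) :=
        Real.rpow_le_rpow (BethePermanent.averageLiftPermanent_nonneg hθ)
          (BethePermanent.averageLiftPermanent_le_permanent_pow hθ) (by positivity)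
    _ = θ.permanent := by
        rw [one_div]
        exact Real.pow_rpow_inv_natCast hperm (by omega)
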